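/- Let $0<\beta\le 1$. There is a constant $C$ depending only on $\beta$ such that the following holds. For $i=1,2,3$ let $\Sigma_i$ be a bounded, relatively open subset of a surface $\Sigma_i^*\subset\mathbb{R}^3$ with $\operatorname{diam}\Sigma_i\le 1$ and $\Sigma_3\neq\emptyset$, such that: 1. $\Sigma_i^*=\{\sigma\in U_i : \Phi_i(\sigma)=0,\ \nabla\Phi_i(\sigma)\ne 0\}$ for an open convex set $U_i\subset\mathbb{R}^3$ with $\operatorname{dist}(\Sigma_i,U_i^c)\ge\operatorname{diam}\Sigma_i$ and a function $\Phi_i\in C^{1,\beta}(U_i)$, that is, $\Phi_i$ is differentiable in $U_i$ and $\nabla\Phi_i$ is locally $\beta$-Hölder continuous there; $\Sigma_i^*$ is oriented by a unit normal vector field $\mathfrak n_i$; 2. for all $\sigma\ne\tilde\sigma$ in $\Sigma_i^*$, $$\frac{|\mathfrak n_i(\sigma)-\mathfrak n_i(\tilde\sigma)|}{|\sigma-\tilde\sigma|^{\beta}}+\frac{|\mathfrak n_i(\sigma)\cdot(\sigma-\tilde\sigma)|}{|\sigma-\tilde\sigma|^{1+\beta}}\le 1;$$ 3. $\tfrac12\le\det\big(\mathfrak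 n_1(\sigma_1),\mathfrak n_2(\sigma_2),\mathfrak n_3(\sigma_3)\big)\le 1$ for all $(\sigma_1,\sigma_2,\sigma_3)\in\Sigma_1^*\times\Sigma_2^*\times\Sigma_3^*$. Let $\mu_i$ be the surface measure on $\Sigma_i$ and let $f\in L^2(\Sigma_1,\mu_1)$, $g\in L^2(\Sigma_2,\mu_2)$ be complex valued. Then the convolution $f\ast g$, that is, the distribution $$(f\ast g)(\psi)=\int_{\Sigma_1}\int_{\Sigma_2} f(x)\,g(y)\,\psi(x+y)\,d\mu_2(y)\,d\mu_1(x),\qquad \psi\in C_c^\infty(\mathbb{R}^3),$$ is (given by) an integrable function on $\mathbb{R}^3$, and for every $0<\varepsilon\le 1$ $$\|f\ast g\|_{L^2(\Sigma_3(\varepsilon))}\le C\sqrt{\varepsilon}\,\|f\|_{L^2(\Sigma_1)}\|g\|_{L^2(\Sigma_2)},$$ where $\Sigma_3(\varepsilon)=\{v\in\mathbb{R}^3 : \operatorname{dist}(v,\Sigma_3)\le\varepsilon\}$ carries Lebesgue measure. -/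

import Mathlib

open MeasureTheory
open scoped Topology ContDiff

/-- Euclidean three-space. -/
abbrev R3 : Type := EuclideanSpace ℝ (Fin 3)

/-- `Φ ∈ C^{1,β}(U)` for an open set `U`: `Φ` is differentiable in `U` and its gradient is
(locally) Hölder continuous in `U` with exponent `β`. -/
def IsC1Holder (β : ℝ) (Φ : R3 → ℝ) (U : Set R3) : Prop :=
  DifferentiableOn ℝ Φ U ∧
    ∀ x ∈ U, ∃ V ∈ 𝓝 x, ∃ K : ℝ, ∀ y ∈ V ∩ U, ∀ z ∈ V ∩ U,
      ‖gradient Φ y - gradient Φ z‖ ≤ K * ‖y - z‖ ^ β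

/-- `S` is a bounded, relatively open subset of the surface `S'`, which is the regular part of the
zero set of a `C^{1,β}` function `Φ` on an open convex set `U` with `dist(S, Uᶜ) ≥ diam S`, and
`n` is a unit normal vector field on `S'` (an orientation). The distance condition is written
pointwise, so that it is void for `U = ℝ³`. -/
def IsRegularSurface (β : ℝ) (S S' : Set R3) (n : R3 → R3) : Prop :=
  Bornology.IsBounded S ∧
  (∃ V : Set R3, IsOpen V ∧ S = S' ∩ V) ∧
  ∃ (U : Set R3) (Φ : R3 → ℝ),
    IsOpen U ∧ Convex ℝ U ∧ IsC1Holder β Φ U ∧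
    S' = {σ | σ ∈ U ∧ Φ σ = 0 ∧ gradient Φ σ ≠ 0} ∧
    (∀ x ∈ S, ∀ y ∉ U, Metric.diam S ≤ dist x y) ∧
    ∀ σ ∈ S', ‖n σ‖ = 1 ∧ ∃ c : ℝ, gradient Φ σ = c • n σ

/-- The scale invariant Hölder condition, with constant `b`, on the unit normal field `n` of
`S'`. -/
def NormalHolder (β b : ℝ) (S' : Set R3) (n : R3 → R3) : Prop :=
  ∀ σ ∈ S', ∀ τ ∈ S', σ ≠ τ →
    ‖n σ - n τ‖ / ‖σ - τ‖ ^ β + |inner ℝ (n σ) (σ - τ)| / ‖σ - τ‖ ^ (1 + β) ≤ b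

/-- The matrix with columns `n₁(σ₁)`, `n₂(σ₂)`, `n₃(σ₃)`. -/
def normalMatrix (n : Fin 3 → R3 → R3) (σ : Fin 3 → R3) : Matrix (Fin 3) (Fin 3) ℝ :=
  Matrix.of fun i j => n j (σ j) i

/-- The hypotheses on the triple of surfaces `S 0`, `S 1`, `S 2`, contained in larger surfaces
`S' i` with unit normal fields `n i`, with parameters `β`, `b`, `θ`. -/
structure SurfaceAssumption (β b θ : ℝ) (S S' : Fin 3 → Set R3) (n : Fin 3 → R3 → R3) :
    Prop where
  regular : ∀ i, IsRegularSurface β (S i) (S' i) (n i)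
  holder : ∀ i, NormalHolder β b (S' i) (n i)
  transversal : ∀ σ : Fin 3 → R3, (∀ i, σ i ∈ S' i) →
    θ ≤ (normalMatrix n σ).det ∧ (normalMatrix n σ).det ≤ 1

/-- The surface measure on `S`: the two-dimensional Hausdorff measure, normalized so as to agree
with Lebesgue measure on planes, restricted to `S`. -/
noncomputable def surfaceMeasure (S : Set R3) : Measure R3 :=
  (Measure.euclideanHausdorffMeasure 2 : Measure R3).restrict S

/-- The function `h ∈ L¹(ℝ³)` represents the convolution of `f` on `S₁` and `g` on `S₂`, that is,
the distribution `ψ ↦ ∫_{S₁} ∫_{S₂} f(x) g(y) ψ(x + y) dμ₂(y) dμ₁(x)`. Such an `h` is unique up to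
a null set. -/
def IsSurfaceConvolution (S₁ S₂ : Set R3) (f g h : R3 → ℂ) : Prop :=
  Integrable h volume ∧
    ∀ ψ : R3 → ℂ, ContDiff ℝ ∞ ψ → HasCompactSupport ψ →
      ∫ v, h v * ψ v =
        ∫ x, ∫ y, f x * g y * ψ (x + y) ∂(surfaceMeasure S₂) ∂(surfaceMeasure S₁)

open scoped ENNReal NNReal

/-! The convolution is studied through ball averages. Let `P` be the image under addition of `|f| μ
⊗ |g| ν`, with `μ`, `ν` the measures on the first two surfaces. Cauchy–Schwarz on `{x + y ∈ B(v,
δ)}`, with `|f|` and `|g|` as the two factors, bounds `P(B(v, δ))²` by `∫ |f|² ν(B(v - x, δ)) dμ`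
times `∫ |g|² μ(B(v - y, δ)) dν`. Each surface ball has mass `O(δ²)` and is empty unless its centre
is within `δ` of the surface.

Integrating over `v` within `ε` of the third surface leaves `δ⁴` times the volume of an intersection
of three neighbourhoods, two of width `δ` and one of width `ε`. At small scales the surfaces are
almost planes with quantitatively independent normals, so this volume is `O(ε δ²)`
(`exists_volume_inter_le`). The total `ε δ⁶` is comparable to `ε |B_δ|²`: the averages `P(B(v, δ)) /
|B_δ|` satisfy the desired `L²` bound uniformly in `δ` (`exists_lintegral_sq_weightedConv_le`).

Such a bound makes `P` absolutely continuous, and Fatou's lemma with differentiation of measures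
transfers it to the density. The complex convolution splits into four nonnegative parts dominated by
`P`. -/

/-! ### Linear algebra of transversal unit normals. -/

theorem norm_le_sum_abs_coord (w : R3) : ‖w‖ ≤ |w 0| + |w 1| + |w 2| := by
  rw [EuclideanSpace.norm_eq, Real.sqrt_le_iff, Fin.sum_univ_three]
  simp only [Real.norm_eq_abs]
  have h0 := abs_nonneg (w 0)
  have h1 := abs_nonneg (w 1)
  have h2 := abs_nonneg (w 2)
  exact ⟨by positivity, by nlinarith [mul_nonneg h0 h1, mul_nonneg h0 h2, mul_nonneg h1 h2]⟩

theorem abs_coord_le_norm (w : R3) (k : Fin 3) : |w k| ≤ ‖w‖ := by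
  simpa using PiLp.norm_apply_le w k

theorem inner_eq_coord (a w : R3) : inner ℝ a w = a 0 * w 0 + a 1 * w 1 + a 2 * w 2 := by
  simp [PiLp.inner_apply, Fin.sum_univ_three, mul_comm]

/-- Three unit vectors spanning a parallelepiped of volume at least `1 / 2` control the norm. -/
theorem norm_le_sum_abs_inner (a : Fin 3 → R3) (ha : ∀ i, ‖a i‖ = 1)
    (hdet : 1 / 2 ≤ (Matrix.of fun i j => a j i : Matrix (Fin 3) (Fin 3) ℝ).det) (w : R3) :
    ‖w‖ ≤ 12 * (|inner ℝ (a 0) w| + |inner ℝ (a 1) w| + |inner ℝ (a 2) w|) := by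
  have hb : ∀ i k, |a i k| ≤ 1 := fun i k => (abs_coord_le_norm (a i) k).trans (ha i).le
  have hcof : ∀ i j k l, |a i k * a j l - a i l * a j k| ≤ 2 := by
    intro i j k l
    have h1 : |a i k * a j l| ≤ 1 := by
      rw [abs_mul]; exact mul_le_one₀ (hb _ _) (abs_nonneg _) (hb _ _)
    have h2 : |a i l * a j k| ≤ 1 := by
      rw [abs_mul]; exact mul_le_one₀ (hb _ _) (abs_nonneg _) (hb _ _)
    exact (abs_sub _ _).trans (by linarith)
  have hcoord : ∀ k, |w k| ≤
      4 * (|inner ℝ (a 0) w| + |inner ℝ (a 1) w| + |inner ℝ (a 2) w|) := by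
    set d := (Matrix.of fun i j => a j i : Matrix (Fin 3) (Fin 3) ℝ).det with hd
    -- Cramer's rule, with `(k, k', l')` a cyclic permutation. The minors are at most 2 and `d ≥
    -- 1/2`, so each coordinate costs a factor 4; three coordinates give the 12.
    have key : ∀ k k' l' : Fin 3,
        w k * d = inner ℝ (a 0) w * (a 1 k' * a 2 l' - a 1 l' * a 2 k')
          + inner ℝ (a 1) w * (a 2 k' * a 0 l' - a 2 l' * a 0 k')
          + inner ℝ (a 2) w * (a 0 k' * a 1 l' - a 0 l' * a 1 k') →
        |w k| ≤ 4 * (|inner ℝ (a 0) w| + |inner ℝ (a 1) w| + |inner ℝ (a 2) w|) := by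
      intro k k' l' h
      have h1 : |w k| * d ≤ 2 * (|inner ℝ (a 0) w| + |inner ℝ (a 1) w| + |inner ℝ (a 2) w|) := by
        have : |w k| * d = |w k * d| := by rw [abs_mul, abs_of_nonneg (by linarith : 0 ≤ d)]
        rw [this, h]
        refine (abs_add_three _ _ _).trans ?_
        simp only [abs_mul]
        have e0 := mul_le_mul_of_nonneg_left (hcof 1 2 k' l') (abs_nonneg (inner ℝ (a 0) w))
        have e1 := mul_le_mul_of_nonneg_left (hcof 2 0 k' l') (abs_nonneg (inner ℝ (a 1) w))
        have e2 := mul_le_mul_of_nonneg_left (hcof 0 1 k' l') (abs_nonneg (inner ℝ (a 2) w))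
        linarith
      nlinarith [abs_nonneg (w k)]
    simp only [Matrix.det_fin_three, Matrix.of_apply] at hd
    intro k
    fin_cases k
    · refine key 0 1 2 ?_
      simp only [inner_eq_coord, hd]; ring
    · refine key 1 2 0 ?_
      simp only [inner_eq_coord, hd]; ring
    · refine key 2 0 1 ?_
      simp only [inner_eq_coord, hd]; ring
  linarith [norm_le_sum_abs_coord w, hcoord 0, hcoord 1, hcoord 2]

/-! ### Flatness and coverings at small scales. -/

/-- At small scales, a surface with Hölder continuous normal is flat. -/
theorem exists_flat_scale {β : ℝ} (hβ : 0 < β) {η : ℝ} (hη : 0 < η) :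
    ∃ c : ℝ, 0 < c ∧ ∀ (S' : Set R3) (n : R3 → R3), NormalHolder β 1 S' n →
      ∀ p ∈ S', ∀ σ ∈ S', ∀ τ ∈ S', dist σ p ≤ c → dist σ τ ≤ c →
        |inner ℝ (n p) (σ - τ)| ≤ η * ‖σ - τ‖ := by
  -- At this scale `r ^ β ≤ η / 2`. One half of `η` pays for replacing `n p` by `n σ`, the other for
  -- the tangency bound at `σ`.
  refine ⟨(η / 2) ^ (1 / β), by positivity, ?_⟩
  intro S' n h p hp σ hσ τ hτ h1 h2
  have hpow : ∀ r : ℝ, 0 ≤ r → r ≤ (η / 2) ^ (1 / β) → r ^ β ≤ η / 2 := by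
    intro r hr hrc
    refine (Real.rpow_le_rpow hr hrc hβ.le).trans ?_
    rw [← Real.rpow_mul (by positivity), one_div_mul_cancel hβ.ne', Real.rpow_one]
  have hn : ‖n σ - n p‖ ≤ η / 2 := by
    rcases eq_or_ne σ p with rfl | hne
    · simpa using by positivity
    · have h3 := h σ hσ p hp hne
      have hpos : 0 < ‖σ - p‖ := norm_pos_iff.2 (sub_ne_zero.2 hne)
      have h4 : ‖n σ - n p‖ / ‖σ - p‖ ^ β ≤ 1 := by
        have : 0 ≤ |inner ℝ (n σ) (σ - p)| / ‖σ - p‖ ^ (1 + β) := by positivity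
        linarith
      rw [div_le_one (by positivity)] at h4
      exact h4.trans (hpow _ hpos.le (by rwa [← dist_eq_norm]))
  rcases eq_or_ne σ τ with rfl | hne
  · simp
  have hpos : 0 < ‖σ - τ‖ := norm_pos_iff.2 (sub_ne_zero.2 hne)
  have h3 := h σ hσ τ hτ hne
  have h4 : |inner ℝ (n σ) (σ - τ)| / ‖σ - τ‖ ^ (1 + β) ≤ 1 := by
    have : 0 ≤ ‖n σ - n τ‖ / ‖σ - τ‖ ^ β := by positivity
    linarith
  rw [div_le_one (by positivity), Real.rpow_add hpos, Real.rpow_one] at h4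
  have h5 : ‖σ - τ‖ ^ β ≤ η / 2 := hpow _ hpos.le (by rwa [← dist_eq_norm])
  have h6 : |inner ℝ (n σ - n p) (σ - τ)| ≤ η / 2 * ‖σ - τ‖ :=
    (abs_real_inner_le_norm _ _).trans (by gcongr)
  have h7 : inner ℝ (n p) (σ - τ) = inner ℝ (n σ) (σ - τ) - inner ℝ (n σ - n p) (σ - τ) := by
    rw [← inner_sub_left]; simp
  rw [h7]
  refine (abs_sub _ _).trans ?_
  nlinarith

/-- Sets of diameter at most one are covered by boundedly many small pieces. -/
theorem exists_small_cover {c : ℝ} (hc : 0 < c) :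
    ∃ t : Finset R3, ∀ S : Set R3, Bornology.IsBounded S → Metric.diam S ≤ 1 →
      ∃ s₀ : R3, ∀ σ ∈ S, ∃ q ∈ t, dist σ (s₀ + q) ≤ c := by
  obtain ⟨t, ht, hcov⟩ := Metric.totallyBounded_iff.1
    (isCompact_closedBall (0 : R3) 1).totallyBounded c hc
  -- After translation by one of its points, every such `S` lies in the unit ball, so a single net
  -- serves all of them and the number of pieces is uniform.
  refine ⟨ht.toFinset, fun S hS hd => ?_⟩
  rcases S.eq_empty_or_nonempty with rfl | ⟨s₀, hs₀⟩
  · exact ⟨0, by simp⟩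
  refine ⟨s₀, fun σ hσ => ?_⟩
  have h1 : σ - s₀ ∈ Metric.closedBall (0 : R3) 1 := by
    rw [mem_closedBall_zero_iff, ← dist_eq_norm]
    exact (Metric.dist_le_diam_of_mem hS hσ hs₀).trans hd
  obtain ⟨q, hq, hlt⟩ := Set.mem_iUnion₂.1 (hcov h1)
  refine ⟨q, by simpa using hq, ?_⟩
  rw [Metric.mem_ball, dist_eq_norm] at hlt
  rw [dist_eq_norm, ← sub_sub]
  exact hlt.le

/-! ### Volume of triple intersections of neighbourhoods. -/

/-- Volume of a set which is `δ`-thin in two directions and `ε`-thin in a third one. -/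
theorem volume_le_of_thin (a₀ a₁ a₂ : R3)
    (hnorm : ∀ w : R3, ‖w‖ ≤
      12 * (|inner ℝ a₀ w| + |inner ℝ a₁ w| + |inner ℝ a₂ w|))
    {δ ε : ℝ} (hδ : 0 < δ) (hδε : δ ≤ ε) (A : Set R3)
    (h0 : ∀ v ∈ A, ∀ v' ∈ A, |inner ℝ a₀ (v - v')| ≤ 1 / 72 * ‖v - v'‖ + 8 * δ)
    (h1 : ∀ v ∈ A, ∀ v' ∈ A, |inner ℝ a₁ (v - v')| ≤ 1 / 72 * ‖v - v'‖ + 8 * δ)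
    (h2 : ∀ v ∈ A, ∀ v' ∈ A, |inner ℝ a₂ (v - v')| ≤ 1 / 72 * ‖v - v'‖ + 8 * ε) :
    volume A ≤ ENNReal.ofReal (2000 * 1000 ^ 3 * ε * δ ^ 2) *
      volume (Metric.closedBall (0 : R3) 1) := by
  rcases A.eq_empty_or_nonempty with rfl | ⟨v₀, hv₀⟩
  · simp
  have hε : 0 < ε := hδ.trans_le hδε
  -- The slope `1/72` is chosen for absorption: `12 * 3 / 72 = 1/2`, so `‖v - v₀‖` moves to the left
  -- and is `O(ε)`. `A` is then cut into `O(ε / δ)` slices of thickness `δ` along `a₂`, each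
  -- contained in a ball of radius `O(δ)`.
  have hdiam : ∀ v ∈ A, |inner ℝ a₂ (v - v₀)| ≤ 600 * ε := by
    intro v hv
    linarith [hnorm (v - v₀), h0 v hv v₀ hv₀, h1 v hv v₀ hv₀, h2 v hv v₀ hv₀]
  set k : R3 → ℤ := fun v => ⌊inner ℝ a₂ (v - v₀) / δ⌋ with hk
  set M : ℕ := ⌈600 * ε / δ⌉₊ with hM
  have hkM : ∀ v ∈ A, k v ∈ Finset.Icc (-(M : ℤ)) M := by
    intro v hv
    have h3 := abs_le.1 (hdiam v hv)
    have h4 : 600 * ε / δ ≤ M := Nat.le_ceil _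
    rw [Finset.mem_Icc]
    constructor
    · rw [Int.le_floor]
      push_cast
      have : -(600 * ε) / δ ≤ inner ℝ a₂ (v - v₀) / δ := by gcongr; exact h3.1
      rw [neg_div] at this
      linarith
    · have h5 : (k v : ℝ) ≤ inner ℝ a₂ (v - v₀) / δ := Int.floor_le _
      have : inner ℝ a₂ (v - v₀) / δ ≤ 600 * ε / δ := by gcongr; exact h3.2
      exact_mod_cast (h5.trans (this.trans h4))
  have hslice : ∀ j : ℤ, volume {v ∈ A | k v = j} ≤
      ENNReal.ofReal (1000 ^ 3 * δ ^ 3) * volume (Metric.closedBall (0 : R3) 1) := by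
    intro j
    rcases Set.eq_empty_or_nonempty {v ∈ A | k v = j} with he | ⟨v', hv', hj'⟩
    · simp [he]
    have hsub : {v ∈ A | k v = j} ⊆ Metric.closedBall v' (1000 * δ) := by
      rintro v ⟨hv, hj⟩
      have h3 : |inner ℝ a₂ (v - v')| ≤ δ := by
        have h4 : |inner ℝ a₂ (v - v₀) / δ - inner ℝ a₂ (v' - v₀) / δ| < 1 :=
          Int.abs_sub_lt_one_of_floor_eq_floor (hj.trans hj'.symm)
        rw [← sub_div, ← inner_sub_right, sub_sub_sub_cancel_right, abs_div, abs_of_pos hδ,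
          div_lt_one hδ] at h4
        exact h4.le
      rw [Metric.mem_closedBall, dist_eq_norm]
      linarith [hnorm (v - v'), h0 v hv v' hv', h1 v hv v' hv']
    refine (measure_mono hsub).trans ?_
    rw [Measure.addHaar_closedBall' volume v' (by positivity)]
    simp [mul_pow]
  have hcover : A ⊆ ⋃ j ∈ Finset.Icc (-(M : ℤ)) M, {v ∈ A | k v = j} := fun v hv =>
    Set.mem_iUnion₂.2 ⟨k v, hkM v hv, hv, rfl⟩
  refine (measure_mono hcover).trans ((measure_biUnion_finset_le _ _).trans
    ((Finset.sum_le_sum fun j _ => hslice j).trans ?_))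
  rw [Finset.sum_const, nsmul_eq_mul, ← mul_assoc]
  gcongr
  rw [← ENNReal.ofReal_natCast, ← ENNReal.ofReal_mul (by positivity)]
  apply ENNReal.ofReal_le_ofReal
  have hcard : ((Finset.Icc (-(M : ℤ)) M).card : ℝ) = 2 * M + 1 := by
    rw [Int.card_Icc]
    have : ((M : ℤ) + 1 - -(M : ℤ)).toNat = 2 * M + 1 := by omega
    rw [this]; push_cast; ring
  have hM' : (M : ℝ) < 600 * ε / δ + 1 := Nat.ceil_lt_add_one (by positivity)
  have h1δ : 1 ≤ ε / δ := by rwa [one_le_div hδ]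
  have h5 : (2 * (M : ℝ) + 1) ≤ 2000 * (ε / δ) := by
    rw [mul_div_assoc] at hM'; linarith
  rw [hcard]
  calc (2 * (M : ℝ) + 1) * (1000 ^ 3 * δ ^ 3) ≤ 2000 * (ε / δ) * (1000 ^ 3 * δ ^ 3) := by gcongr
    _ = 2000 * 1000 ^ 3 * ε * δ ^ 2 := by field_simp

/-- The factor 2 is there because `S` need not be closed and the distance need not be attained. -/
theorem exists_dist_le_of_mem_cthickening {S : Set R3} {δ : ℝ} (hδ : 0 < δ) {v : R3}
    (hv : v ∈ Metric.cthickening δ S) : ∃ σ ∈ S, dist v σ ≤ 2 * δ := by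
  obtain ⟨σ, hσ, h⟩ := Metric.mem_thickening_iff.1
    (Metric.cthickening_subset_thickening' (by positivity) (by linarith : δ < 2 * δ) S hv)
  exact ⟨σ, hσ, h.le⟩

/-- Points close to a flat piece of surface inherit the flatness. -/
theorem abs_inner_sub_le_of_dist_le {m σ τ v w : R3} (hm : ‖m‖ = 1) {δ : ℝ}
    (hflat : |inner ℝ m (σ - τ)| ≤ 1 / 72 * ‖σ - τ‖)
    (h1 : ‖v - σ‖ ≤ 2 * δ) (h2 : ‖w - τ‖ ≤ 2 * δ) :
    |inner ℝ m (v - w)| ≤ 1 / 72 * ‖v - w‖ + 8 * δ := by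
  have e : v - w = (σ - τ) + ((v - σ) - (w - τ)) := by abel
  have h3 : ‖(v - σ) - (w - τ)‖ ≤ 4 * δ := (norm_sub_le _ _).trans (by linarith)
  have h4 : |inner ℝ m ((v - σ) - (w - τ))| ≤ 4 * δ := by
    refine (abs_real_inner_le_norm _ _).trans ?_
    rwa [hm, one_mul]
  have h5 : ‖σ - τ‖ ≤ ‖v - w‖ + 4 * δ := by
    have : σ - τ = (v - w) - ((v - σ) - (w - τ)) := by abel
    rw [this]
    exact (norm_sub_le _ _).trans (by linarith)
  have h6 : |inner ℝ m (v - w)| ≤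
      |inner ℝ m (σ - τ)| + |inner ℝ m ((v - σ) - (w - τ))| := by
    conv_lhs => rw [e, inner_add_right]
    exact abs_add_le _ _
  linarith [norm_nonneg (σ - τ), norm_nonneg ((v - σ) - (w - τ))]

/-- The `ε`-neighbourhood of the third surface meets the intersection of `δ`-neighbourhoods of
translates of the first two surfaces in a set of volume `O(ε δ²)`. -/
theorem exists_volume_inter_le {β : ℝ} (hβ : 0 < β) :
    ∃ C : ℝ≥0, ∀ (S S' : Fin 3 → Set R3) (n : Fin 3 → R3 → R3),
      SurfaceAssumption β 1 (1 / 2) S S' n → (∀ i, Metric.diam (S i) ≤ 1) →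
      ∀ (x y : R3) (δ ε : ℝ), 0 < δ → δ ≤ ε →
        volume {v | v ∈ Metric.cthickening ε (S 2) ∧ v - x ∈ Metric.cthickening δ (S 1) ∧
          v - y ∈ Metric.cthickening δ (S 0)} ≤ C * ENNReal.ofReal (ε * δ ^ 2) := by
  obtain ⟨c, hc, hflat⟩ := exists_flat_scale hβ (by norm_num : (0 : ℝ) < 1 / 72)
  -- Radius `c / 2` gives pieces of diameter at most `c`, so flatness applies to all pairs in a
  -- piece, with the normal frozen at any of its points.
  obtain ⟨t, ht⟩ := exists_small_cover (half_pos hc)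
  have hball : volume (Metric.closedBall (0 : R3) 1) ≠ ⊤ := measure_closedBall_lt_top.ne
  refine ⟨t.card * t.card * t.card * (2000 * 1000 ^ 3) *
    (volume (Metric.closedBall (0 : R3) 1)).toNNReal, ?_⟩
  intro S S' n hS hdiam x y δ ε hδ hδε
  have hε : 0 < ε := hδ.trans_le hδε
  have hsub : ∀ i, S i ⊆ S' i := fun i => by
    obtain ⟨-, ⟨V, -, hV⟩, -⟩ := hS.regular i
    rw [hV]; exact Set.inter_subset_left
  have hunit : ∀ i, ∀ σ ∈ S' i, ‖n i σ‖ = 1 := fun i σ hσ => by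
    obtain ⟨-, -, U, Φ, -, -, -, -, -, h⟩ := hS.regular i
    exact (h σ hσ).1
  choose s₀ hs₀ using fun i => ht (S i) (hS.regular i).1 (hdiam i)
  set piece : Fin 3 → R3 → Set R3 := fun i q => {σ ∈ S i | dist σ (s₀ i + q) ≤ c / 2} with hpiece
  have hpd : ∀ i q, ∀ σ ∈ piece i q, ∀ τ ∈ piece i q, dist σ τ ≤ c := by
    rintro i q σ ⟨-, h1⟩ τ ⟨-, h2⟩
    rw [dist_comm] at h2
    linarith [dist_triangle σ (s₀ i + q) τ]
  have hpf : ∀ i q, ∀ p ∈ piece i q, ∀ σ ∈ piece i q, ∀ τ ∈ piece i q,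
      |inner ℝ (n i p) (σ - τ)| ≤ 1 / 72 * ‖σ - τ‖ := fun i q p hp σ hσ τ hτ =>
    hflat _ _ (hS.holder i) p (hsub i hp.1) σ (hsub i hσ.1) τ (hsub i hτ.1)
      (hpd i q σ hσ p hp) (hpd i q σ hσ τ hτ)
  set A : R3 × R3 × R3 → Set R3 := fun q =>
    {v | (∃ σ ∈ piece 2 q.1, ‖v - σ‖ ≤ 2 * ε) ∧ (∃ σ ∈ piece 1 q.2.1, ‖v - x - σ‖ ≤ 2 * δ) ∧
      ∃ σ ∈ piece 0 q.2.2, ‖v - y - σ‖ ≤ 2 * δ} with hA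
  have hvol : ∀ q, volume (A q) ≤ ENNReal.ofReal (2000 * 1000 ^ 3 * ε * δ ^ 2) *
      volume (Metric.closedBall (0 : R3) 1) := by
    intro q
    rcases (A q).eq_empty_or_nonempty with he | ⟨v₀, ⟨p₂, hp₂, -⟩, ⟨p₁, hp₁, -⟩, p₀, hp₀, -⟩
    · simp [he]
    have hp : ∀ i, ![p₀, p₁, p₂] i ∈ S' i := by
      intro i
      fin_cases i
      exacts [hsub 0 hp₀.1, hsub 1 hp₁.1, hsub 2 hp₂.1]
    have hdet := (hS.transversal ![p₀, p₁, p₂] hp).1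
    have hnorm : ∀ w : R3, ‖w‖ ≤ 12 * (|inner ℝ (n 0 p₀) w| + |inner ℝ (n 1 p₁) w| +
        |inner ℝ (n 2 p₂) w|) := norm_le_sum_abs_inner (fun i => n i (![p₀, p₁, p₂] i))
      (fun i => hunit i _ (hp i)) hdet
    refine volume_le_of_thin (n 0 p₀) (n 1 p₁) (n 2 p₂) hnorm hδ hδε (A q) ?_ ?_ ?_
    · rintro v ⟨-, -, σ, hσ, h1⟩ w ⟨-, -, τ, hτ, h2⟩
      have := abs_inner_sub_le_of_dist_le (hunit 0 p₀ (hsub 0 hp₀.1)) (hpf 0 _ p₀ hp₀ σ hσ τ hτ) h1 h2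
      rwa [sub_sub_sub_cancel_right] at this
    · rintro v ⟨-, ⟨σ, hσ, h1⟩, -⟩ w ⟨-, ⟨τ, hτ, h2⟩, -⟩
      have := abs_inner_sub_le_of_dist_le (hunit 1 p₁ (hsub 1 hp₁.1)) (hpf 1 _ p₁ hp₁ σ hσ τ hτ) h1 h2
      rwa [sub_sub_sub_cancel_right] at this
    · rintro v ⟨⟨σ, hσ, h1⟩, -⟩ w ⟨⟨τ, hτ, h2⟩, -⟩
      exact abs_inner_sub_le_of_dist_le (hunit 2 p₂ (hsub 2 hp₂.1)) (hpf 2 _ p₂ hp₂ σ hσ τ hτ) h1 h2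
  have hcover : {v | v ∈ Metric.cthickening ε (S 2) ∧ v - x ∈ Metric.cthickening δ (S 1) ∧
      v - y ∈ Metric.cthickening δ (S 0)} ⊆ ⋃ q ∈ t ×ˢ t ×ˢ t, A q := by
    rintro v ⟨h2, h1, h0⟩
    obtain ⟨σ₂, hσ₂, d₂⟩ := exists_dist_le_of_mem_cthickening hε h2
    obtain ⟨σ₁, hσ₁, d₁⟩ := exists_dist_le_of_mem_cthickening hδ h1
    obtain ⟨σ₀, hσ₀, d₀⟩ := exists_dist_le_of_mem_cthickening hδ h0
    rw [dist_eq_norm] at d₀ d₁ d₂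
    obtain ⟨q₂, hq₂, e₂⟩ := hs₀ 2 σ₂ hσ₂
    obtain ⟨q₁, hq₁, e₁⟩ := hs₀ 1 σ₁ hσ₁
    obtain ⟨q₀, hq₀, e₀⟩ := hs₀ 0 σ₀ hσ₀
    refine Set.mem_iUnion₂.2 ⟨(q₂, q₁, q₀), by simp [hq₀, hq₁, hq₂], ?_⟩
    exact ⟨⟨σ₂, ⟨hσ₂, e₂⟩, d₂⟩, ⟨σ₁, ⟨hσ₁, e₁⟩, d₁⟩, ⟨σ₀, ⟨hσ₀, e₀⟩, d₀⟩⟩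
  refine (measure_mono hcover).trans ((measure_biUnion_finset_le _ _).trans
    ((Finset.sum_le_sum fun q _ => hvol q).trans (le_of_eq ?_)))
  rw [Finset.sum_const, nsmul_eq_mul, Finset.card_product, Finset.card_product]
  have e1 : ENNReal.ofReal (2000 * 1000 ^ 3 * ε * δ ^ 2) =
      (2000 * 1000 ^ 3 : ℝ≥0∞) * ENNReal.ofReal (ε * δ ^ 2) := by
    rw [mul_assoc, ENNReal.ofReal_mul (by positivity)]
    congr 1
    norm_num
  rw [e1]
  push_cast
  rw [ENNReal.coe_toNNReal hball]
  ring

/-! ### Surface measure of small balls. -/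

/-- Upper regularity of surface measure. -/
theorem exists_surfaceMeasure_closedBall_le {β : ℝ} (hβ : 0 < β) :
    ∃ (C : ℝ≥0) (c : ℝ), 0 < c ∧ ∀ (S S' : Set R3) (n : R3 → R3), IsRegularSurface β S S' n →
      NormalHolder β 1 S' n → ∀ (p : R3) (δ : ℝ), 0 < δ → δ ≤ c →
        surfaceMeasure S (Metric.closedBall p δ) ≤ C * ENNReal.ofReal (δ ^ 2) := by
  obtain ⟨c, hc, hflat⟩ := exists_flat_scale hβ (by norm_num : (0 : ℝ) < 1 / 72)
  obtain ⟨κ, hκ⟩ : ∃ κ : ℝ≥0, (Measure.euclideanHausdorffMeasure 2 : Measure R3) = κ • μH[2] :=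
    ⟨_, Measure.euclideanHausdorffMeasure_def 2⟩
  refine ⟨κ * (7 ^ 2 * 2 ^ 2), c / 2, by positivity, ?_⟩
  intro S S' n hS hn p δ hδ hδc
  rw [surfaceMeasure, Measure.restrict_apply Metric.isClosed_closedBall.measurableSet]
  set A := Metric.closedBall p δ ∩ S with hA
  have hsub : S ⊆ S' := by
    obtain ⟨-, ⟨V, -, hV⟩, -⟩ := hS
    rw [hV]; exact Set.inter_subset_left
  rcases A.eq_empty_or_nonempty with he | ⟨p', hp'⟩
  · simp [he]
  have hunit : ‖n p'‖ = 1 := by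
    obtain ⟨-, -, U, Φ, -, -, -, -, -, h⟩ := hS
    exact (h p' (hsub hp'.2)).1
  have hd : ∀ σ ∈ A, ∀ τ ∈ A, dist σ τ ≤ c := by
    intro σ hσ τ hτ
    have h1 := Metric.mem_closedBall.1 hσ.1
    have h2 := Metric.mem_closedBall'.1 hτ.1
    linarith [dist_triangle σ p τ]
  have hf : ∀ σ ∈ A, ∀ τ ∈ A, |inner ℝ (n p') (σ - τ)| ≤ 1 / 72 * ‖σ - τ‖ := fun σ hσ τ hτ =>
    hflat S' n hn p' (hsub hp'.2) σ (hsub hσ.2) τ (hsub hτ.2) (hd _ hσ _ hp') (hd _ hσ _ hτ)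
  obtain ⟨k, hk⟩ : ∃ k, 1 / 2 ≤ |n p' k| := by
    by_contra! h
    have h1 : ‖n p'‖ ^ 2 = n p' 0 ^ 2 + n p' 1 ^ 2 + n p' 2 ^ 2 := by
      rw [EuclideanSpace.norm_sq_eq, Fin.sum_univ_three]; simp
    have h2 : ∀ k, n p' k ^ 2 ≤ 1 / 4 := fun k => by
      rw [← sq_abs]; nlinarith [h k, abs_nonneg (n p' k)]
    rw [hunit] at h1
    linarith [h2 0, h2 1, h2 2]
  set π : R3 → (Fin 2 → ℝ) := fun w j => w (k.succAbove j) with hπ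
  -- The piece is a Lipschitz graph over the plane that omits the `k`-th coordinate. Since `|n p' k|
  -- ≥ 1/2`, flatness bounds that coordinate by `‖σ - τ‖ / 36 + 4 D`, where `D` is the projected
  -- distance; hence `(35/36) ‖σ - τ‖ ≤ 6 D`.
  have hanti : ∀ σ ∈ A, ∀ τ ∈ A, dist σ τ ≤ 7 * dist (π σ) (π τ) := by
    intro σ hσ τ hτ
    have hj : ∀ j, |(σ - τ) (k.succAbove j)| ≤ dist (π σ) (π τ) := fun j => by
      simpa [Real.dist_eq] using dist_le_pi_dist (π σ) (π τ) j
    have hb : ∀ i, |n p' i * (σ - τ) i| ≤ |(σ - τ) i| := fun i => by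
      rw [abs_mul]
      exact mul_le_of_le_one_left (abs_nonneg _) ((abs_coord_le_norm _ i).trans hunit.le)
    have hin := hf σ hσ τ hτ
    rw [inner_eq_coord] at hin
    have hsum := norm_le_sum_abs_coord (σ - τ)
    have hlow : |(σ - τ) k| ≤ 2 * |n p' k * (σ - τ) k| := by
      rw [abs_mul]
      nlinarith [abs_nonneg ((σ - τ) k)]
    have hsplit := Fin.sum_univ_succAbove (fun i => n p' i * (σ - τ) i) k
    rw [Fin.sum_univ_three, Fin.sum_univ_two] at hsplit
    have hk' : |n p' k * (σ - τ) k| ≤ 1 / 72 * ‖σ - τ‖ +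
        (|(σ - τ) (k.succAbove 0)| + |(σ - τ) (k.succAbove 1)|) := by
      rw [hsplit] at hin
      have h0 := abs_le.1 (hb (k.succAbove 0))
      have h1 := abs_le.1 (hb (k.succAbove 1))
      have h2 := abs_le.1 hin
      rw [abs_le]
      constructor <;> linarith
    have hsum' : |(σ - τ) 0| + |(σ - τ) 1| + |(σ - τ) 2| =
        |(σ - τ) k| + (|(σ - τ) (k.succAbove 0)| + |(σ - τ) (k.succAbove 1)|) := by
      have := Fin.sum_univ_succAbove (fun i => |(σ - τ) i|) k
      rwa [Fin.sum_univ_three, Fin.sum_univ_two] at this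
    rw [dist_eq_norm]
    linarith [hj 0, hj 1, dist_nonneg (x := π σ) (y := π τ)]
  have hinj : Set.InjOn π A := by
    intro σ hσ τ hτ h
    have := hanti σ hσ τ hτ
    rw [h, dist_self, mul_zero] at this
    exact dist_le_zero.1 this
  have hleft : Set.LeftInvOn (Function.invFunOn π A) π A := hinj.leftInvOn_invFunOn
  have hlip : LipschitzOnWith 7 (Function.invFunOn π A) (π '' A) := by
    apply LipschitzOnWith.of_dist_le_mul
    rintro _ ⟨σ, hσ, rfl⟩ _ ⟨τ, hτ, rfl⟩
    rw [hleft hσ, hleft hτ]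
    exact hanti σ hσ τ hτ
  have himg : π '' A ⊆ Metric.closedBall (π p) δ := by
    rintro _ ⟨σ, hσ, rfl⟩
    rw [Metric.mem_closedBall, dist_pi_le_iff hδ.le]
    intro j
    rw [Real.dist_eq]
    have := abs_coord_le_norm (σ - p) (k.succAbove j)
    rw [← dist_eq_norm] at this
    exact this.trans hσ.1
  have h1 := hlip.hausdorffMeasure_image_le (d := 2) (by norm_num)
  rw [hleft.image_image] at h1
  have h2 : (μH[2] : Measure (Fin 2 → ℝ)) (π '' A) ≤ ENNReal.ofReal ((2 * δ) ^ 2) := by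
    refine (measure_mono himg).trans ?_
    -- For the sup metric on the plane, Hausdorff measure is exactly Lebesgue measure; the
    -- normalization on `R3` enters only through `κ`.
    have e : (μH[2] : Measure (Fin 2 → ℝ)) = volume := by
      simpa using hausdorffMeasure_pi_real (ι := Fin 2)
    rw [e, Real.volume_pi_closedBall _ hδ.le]
    simp
  rw [hκ, Measure.smul_apply, ENNReal.smul_def, smul_eq_mul]
  calc (κ : ℝ≥0∞) * μH[2] A ≤ κ * (((7 : ℝ≥0) : ℝ≥0∞) ^ (2 : ℝ) * ENNReal.ofReal ((2 * δ) ^ 2)) := by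
        gcongr
        exact h1.trans (by gcongr)
    _ = _ := by
        rw [mul_pow, ENNReal.ofReal_mul (by positivity), ENNReal.rpow_ofNat,
          ENNReal.ofReal_pow (by norm_num), ENNReal.ofReal_ofNat]
        push_cast
        ring

/-! ### Cauchy–Schwarz bound for the mollified convolution. -/

/-- The convolution of the measures `F μ` and `G ν`. -/
noncomputable def weightedConv (μ ν : Measure R3) (F G : R3 → ℝ≥0∞) : Measure R3 :=
  ((μ.prod ν).withDensity fun z => F z.1 * G z.2).map fun z => z.1 + z.2

theorem sq_lintegral_mul_le {α : Type*} [MeasurableSpace α] (μ : Measure α) {F G : α → ℝ≥0∞}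
    (hF : Measurable F) (hG : Measurable G) :
    (∫⁻ a, F a * G a ∂μ) ^ 2 ≤ (∫⁻ a, F a ^ 2 ∂μ) * ∫⁻ a, G a ^ 2 ∂μ := by
  have h := ENNReal.lintegral_mul_le_Lp_mul_Lq μ Real.HolderConjugate.two_two
    hF.aemeasurable hG.aemeasurable
  simp only [Pi.mul_apply, ENNReal.rpow_ofNat] at h
  calc (∫⁻ a, F a * G a ∂μ) ^ 2
      ≤ ((∫⁻ a, F a ^ 2 ∂μ) ^ (1 / 2 : ℝ) * (∫⁻ a, G a ^ 2 ∂μ) ^ (1 / 2 : ℝ)) ^ 2 := by gcongr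
    _ = _ := by
      rw [mul_pow, ← ENNReal.rpow_ofNat, ← ENNReal.rpow_ofNat, ← ENNReal.rpow_mul,
        ← ENNReal.rpow_mul]
      norm_num

/-- Cauchy–Schwarz separates `F` from `G` rather than `F G` from 1. Integrating out the free
variable in each factor then leaves the mass of a translate of `B` for the other measure, so both
surface measures contribute smallness. -/
theorem sq_weightedConv_le (μ ν : Measure R3) [SFinite μ] [SFinite ν] {F G : R3 → ℝ≥0∞}
    (hF : Measurable F) (hG : Measurable G) {B : Set R3} (hB : MeasurableSet B) :
    weightedConv μ ν F G B ^ 2 ≤ (∫⁻ x, F x ^ 2 * ν {y | x + y ∈ B} ∂μ) *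
      ∫⁻ y, G y ^ 2 * μ {x | x + y ∈ B} ∂ν := by
  have hadd : Measurable fun z : R3 × R3 => z.1 + z.2 := measurable_fst.add measurable_snd
  have hB' : MeasurableSet ((fun z : R3 × R3 => z.1 + z.2) ⁻¹' B) := hadd hB
  have hF1 : Measurable fun z : R3 × R3 => F z.1 := hF.comp measurable_fst
  have hG2 : Measurable fun z : R3 × R3 => G z.2 := hG.comp measurable_snd
  rw [weightedConv, Measure.map_apply hadd hB, withDensity_apply _ hB']
  refine (sq_lintegral_mul_le _ hF1 hG2).trans (le_of_eq ?_)
  rw [← lintegral_indicator hB', ← lintegral_indicator hB']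
  congr 1
  · rw [lintegral_prod _ (((hF1.pow_const 2).indicator hB').aemeasurable)]
    refine lintegral_congr fun x => ?_
    have hx : MeasurableSet {y | x + y ∈ B} := (measurable_const_add x) hB
    rw [← lintegral_indicator_const hx]
    rfl
  · rw [lintegral_prod_symm _ (((hG2.pow_const 2).indicator hB').aemeasurable)]
    refine lintegral_congr fun y => ?_
    have hy : MeasurableSet {x | x + y ∈ B} := (measurable_add_const y) hB
    rw [← lintegral_indicator_const hy]
    rfl

theorem setOf_add_mem_closedBall (x v : R3) (δ : ℝ) :
    {y | x + y ∈ Metric.closedBall v δ} = Metric.closedBall (v - x) δ := by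
  ext y
  simp only [Set.mem_ofPred_eq, mem_closedBall_iff_norm]
  rw [show x + y - v = y - (v - x) by abel]

/-- The mollified convolution is square integrable, with a bound in terms of the volumes of the
intersections of neighbourhoods of translates. -/
theorem lintegral_sq_weightedConv_closedBall_le (μ ν : Measure R3) [SFinite μ] [SFinite ν]
    {F G : R3 → ℝ≥0∞} (hF : Measurable F) (hG : Measurable G) {N₁ N₂ E : Set R3}
    (hN₁ : MeasurableSet N₁) (hN₂ : MeasurableSet N₂) {δ : ℝ}
    {m V : ℝ≥0∞} (hμ : ∀ p, μ (Metric.closedBall p δ) ≤ N₁.indicator (fun _ => m) p)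
    (hν : ∀ p, ν (Metric.closedBall p δ) ≤ N₂.indicator (fun _ => m) p)
    (hV : ∀ x y, volume {v | v ∈ E ∧ v - x ∈ N₂ ∧ v - y ∈ N₁} ≤ V) :
    ∫⁻ v in E, weightedConv μ ν F G (Metric.closedBall v δ) ^ 2 ≤
      m ^ 2 * V * (∫⁻ x, F x ^ 2 ∂μ) * ∫⁻ y, G y ^ 2 ∂ν := by
  set a : R3 → R3 → ℝ≥0∞ := fun v x => F x ^ 2 * N₂.indicator (fun _ => m) (v - x) with ha
  set b : R3 → R3 → ℝ≥0∞ := fun v y => G y ^ 2 * N₁.indicator (fun _ => m) (v - y) with hb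
  have ham : Measurable (Function.uncurry a) :=
    ((hF.comp measurable_snd).pow_const 2).mul
      ((measurable_const.indicator hN₂).comp (measurable_fst.sub measurable_snd))
  have hbm : Measurable (Function.uncurry b) :=
    ((hG.comp measurable_snd).pow_const 2).mul
      ((measurable_const.indicator hN₁).comp (measurable_fst.sub measurable_snd))
  have hbx : ∀ v, Measurable (b v) := fun v => hbm.comp measurable_prodMk_left
  have hax : ∀ v, Measurable (a v) := fun v => ham.comp measurable_prodMk_left
  have hpt : ∀ v, weightedConv μ ν F G (Metric.closedBall v δ) ^ 2 ≤
      ∫⁻ x, ∫⁻ y, a v x * b v y ∂ν ∂μ := by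
    intro v
    refine (sq_weightedConv_le μ ν hF hG Metric.isClosed_closedBall.measurableSet).trans ?_
    rw [lintegral_congr fun x => lintegral_const_mul (a v x) (hbx v), lintegral_mul_const _ (hax v)]
    gcongr with x y
    · rw [setOf_add_mem_closedBall]
      exact mul_le_mul_right (hν _) _
    · simp_rw [add_comm _ y]
      rw [setOf_add_mem_closedBall]
      exact mul_le_mul_right (hμ _) _
  have hab : Measurable fun z : (R3 × R3) × R3 => a z.1.1 z.1.2 * b z.1.1 z.2 :=
    (ham.comp measurable_fst).mul
      (hbm.comp ((measurable_fst.comp measurable_fst).prodMk measurable_snd))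
  calc ∫⁻ v in E, weightedConv μ ν F G (Metric.closedBall v δ) ^ 2
      ≤ ∫⁻ v in E, ∫⁻ x, ∫⁻ y, a v x * b v y ∂ν ∂μ := lintegral_mono hpt
    _ = ∫⁻ x, ∫⁻ v in E, ∫⁻ y, a v x * b v y ∂ν ∂volume ∂μ :=
        lintegral_lintegral_swap hab.lintegral_prod_right'.aemeasurable
    _ = ∫⁻ x, ∫⁻ y, ∫⁻ v in E, a v x * b v y ∂volume ∂ν ∂μ := by
        refine lintegral_congr fun x => lintegral_lintegral_swap ?_
        exact (hab.comp ((measurable_fst.prodMk measurable_const).prodMk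
          measurable_snd)).aemeasurable
    _ ≤ ∫⁻ x, ∫⁻ y, F x ^ 2 * (m ^ 2 * V) * G y ^ 2 ∂ν ∂μ := by
        gcongr with x y
        have hD : MeasurableSet {v | v - x ∈ N₂ ∧ v - y ∈ N₁} :=
          ((measurable_id.sub_const x) hN₂).inter ((measurable_id.sub_const y) hN₁)
        have e : ∀ v, a v x * b v y = F x ^ 2 * m ^ 2 * G y ^ 2 *
            {v | v - x ∈ N₂ ∧ v - y ∈ N₁}.indicator 1 v := by
          intro v
          simp only [ha, hb]
          by_cases h2 : v - x ∈ N₂ <;> by_cases h1 : v - y ∈ N₁ <;> simp [h1, h2]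
          ring
        simp_rw [e]
        rw [lintegral_const_mul _ (measurable_one.indicator hD), lintegral_indicator_one hD,
          Measure.restrict_apply hD]
        calc F x ^ 2 * m ^ 2 * G y ^ 2 * volume ({v | v - x ∈ N₂ ∧ v - y ∈ N₁} ∩ E)
            ≤ F x ^ 2 * m ^ 2 * G y ^ 2 * V := by
              gcongr
              refine (measure_mono ?_).trans (hV x y)
              exact fun v hv => ⟨hv.2, hv.1⟩
          _ = _ := by ring
    _ = m ^ 2 * V * (∫⁻ x, F x ^ 2 ∂μ) * ∫⁻ y, G y ^ 2 ∂ν := by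
        rw [lintegral_congr fun x => lintegral_const_mul _ (hG.pow_const 2),
          lintegral_mul_const _ ((hF.pow_const 2).mul_const _),
          lintegral_mul_const _ (hF.pow_const 2)]
        ring

/-! ### From ball averages to densities. -/

theorem measurable_measure_closedBall (P : Measure R3) [SFinite P] (δ : ℝ) :
    Measurable fun v => P (Metric.closedBall v δ) := by
  have h : MeasurableSet {z : R3 × R3 | dist z.2 z.1 ≤ δ} :=
    measurableSet_le (measurable_snd.dist measurable_fst) measurable_const
  exact measurable_measure_prodMk_left h

theorem volume_closedBall_eq (v : R3) (δ : ℝ) :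
    volume (Metric.closedBall v δ) = volume (Metric.closedBall (0 : R3) δ) :=
  Measure.addHaar_closedBall_center volume v δ

/-- A uniform local `L²` bound for ball averages forces absolute continuity. -/
theorem absolutelyContinuous_of_lintegral_sq_closedBall_le (P : Measure R3) [IsFiniteMeasure P]
    (h : ∀ R : ℝ, ∃ K : ℝ≥0∞, K ≠ ⊤ ∧ ∃ δ₀ : ℝ, 0 < δ₀ ∧ ∀ δ : ℝ, 0 < δ → δ ≤ δ₀ →
      ∫⁻ v in Metric.closedBall (0 : R3) R, P (Metric.closedBall v δ) ^ 2 ≤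
        K * volume (Metric.closedBall (0 : R3) δ) ^ 2) :
    P ≪ volume := by
  refine Measure.AbsolutelyContinuous.mk fun s hs hs0 => ?_
  rw [hs.measure_eq_iSup_isCompact P]
  simp only [ENNReal.iSup_eq_zero]
  intro A hAs hA
  have hA0 : volume A = 0 := measure_mono_null hAs hs0
  obtain ⟨R, hR⟩ := (hA.isBounded.cthickening (δ := 1)).subset_closedBall 0
  obtain ⟨K, hK, δ₀, hδ₀, hb⟩ := h R
  have key : ∀ δ : ℝ, 0 < δ → δ ≤ min δ₀ 1 →
      P A ^ 2 ≤ volume (Metric.cthickening δ A) * K := by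
    intro δ hδ hδ'
    set W := volume (Metric.closedBall (0 : R3) δ) with hW
    have hW0 : W ≠ 0 := (Metric.measure_closedBall_pos volume 0 hδ).ne'
    have hWt : W ≠ ⊤ := measure_closedBall_lt_top.ne
    have hD : MeasurableSet {z : R3 × R3 | dist z.2 z.1 ≤ δ} :=
      measurableSet_le (measurable_snd.dist measurable_fst) measurable_const
    -- Fubini: a ball centred in `A` lies in the `δ`-neighbourhood of `A`. Cauchy–Schwarz on that
    -- neighbourhood bounds `(P A)²` by `K` times its volume, which tends to `volume A = 0` because
    -- `A` is compact.
    have h1 : P A * W ≤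
        ∫⁻ v in Metric.cthickening δ A, 1 * P (Metric.closedBall v δ) := by
      calc P A * W = ∫⁻ p in A, volume (Metric.closedBall p δ) ∂P := by
            simp_rw [volume_closedBall_eq, lintegral_const, Measure.restrict_apply_univ, mul_comm]
            rfl
        _ ≤ ∫⁻ p in A, ∫⁻ v in Metric.cthickening δ A,
              {z : R3 × R3 | dist z.2 z.1 ≤ δ}.indicator 1 (v, p) ∂volume ∂P := by
            refine setLIntegral_mono' hA.measurableSet fun p hp => ?_
            have e : (fun v => {z : R3 × R3 | dist z.2 z.1 ≤ δ}.indicator (1 : R3 × R3 → ℝ≥0∞) (v, p)) =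
                (Metric.closedBall p δ).indicator 1 := by
              ext v
              by_cases hv : dist v p ≤ δ <;> simp [Set.indicator, dist_comm p v, hv]
            rw [e, lintegral_indicator_one Metric.isClosed_closedBall.measurableSet,
              Measure.restrict_apply Metric.isClosed_closedBall.measurableSet]
            refine measure_mono fun v hv => ⟨hv, ?_⟩
            exact Metric.mem_cthickening_of_dist_le v p δ A hp hv
        _ = ∫⁻ v in Metric.cthickening δ A, ∫⁻ p in A,
              {z : R3 × R3 | dist z.2 z.1 ≤ δ}.indicator 1 (v, p) ∂P := by
            refine lintegral_lintegral_swap ?_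
            exact ((measurable_one.indicator hD).comp measurable_swap).aemeasurable
        _ ≤ ∫⁻ v in Metric.cthickening δ A, 1 * P (Metric.closedBall v δ) := by
            gcongr with v
            have e : (fun p => {z : R3 × R3 | dist z.2 z.1 ≤ δ}.indicator (1 : R3 × R3 → ℝ≥0∞) (v, p)) =
                (Metric.closedBall v δ).indicator 1 := by
              ext p
              by_cases hv : dist p v ≤ δ <;> simp [Set.indicator, hv]
            rw [e, lintegral_indicator_one Metric.isClosed_closedBall.measurableSet, one_mul]
            exact Measure.restrict_apply_le _ _
    have h2 : (P A * W) ^ 2 ≤ volume (Metric.cthickening δ A) * (K * W ^ 2) := by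
      refine (pow_le_pow_left' h1 2).trans
        ((sq_lintegral_mul_le _ measurable_one (measurable_measure_closedBall P δ)).trans ?_)
      gcongr
      · simp
      · refine (lintegral_mono_set ?_).trans (hb δ hδ (hδ'.trans (min_le_left _ _)))
        exact (Metric.cthickening_mono (hδ'.trans (min_le_right _ _)) A).trans hR
    rw [mul_pow, ← mul_assoc] at h2
    exact (ENNReal.mul_le_mul_iff_left (pow_ne_zero 2 hW0) (ENNReal.pow_ne_top hWt)).1 h2
  have hlim : Filter.Tendsto (fun δ => volume (Metric.cthickening δ A) * K) (𝓝[>] 0) (𝓝 0) := by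
    have h1 := (tendsto_measure_cthickening_of_isCompact (μ := (volume : Measure R3)) hA).mono_left
      (nhdsWithin_le_nhds (s := Set.Ioi 0))
    rw [hA0] at h1
    simpa using ENNReal.Tendsto.mul_const h1 (Or.inr hK)
  have h0 : P A ^ 2 ≤ 0 := by
    refine ge_of_tendsto hlim ?_
    have : Set.Ioc 0 (min δ₀ 1) ∈ 𝓝[>] (0 : ℝ) := Ioc_mem_nhdsGT (lt_min hδ₀ one_pos)
    filter_upwards [this] with δ hδ
    exact key δ hδ.1 hδ.2
  exact pow_eq_zero_iff two_ne_zero |>.1 (le_antisymm h0 bot_le)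

/-- An `L²` bound for ball averages passes to the density. -/
theorem lintegral_sq_rnDeriv_le (P : Measure R3) [IsFiniteMeasure P] (E : Set R3) {K : ℝ≥0∞}
    {δ₀ : ℝ} (hδ₀ : 0 < δ₀) (h : ∀ δ : ℝ, 0 < δ → δ ≤ δ₀ →
      ∫⁻ v in E, P (Metric.closedBall v δ) ^ 2 ≤ K * volume (Metric.closedBall (0 : R3) δ) ^ 2) :
    ∫⁻ v in E, P.rnDeriv volume v ^ 2 ≤ K := by
  have hae : ∀ᵐ v ∂(volume.restrict E), Filter.Tendsto
      (fun r => (P (Metric.closedBall v r) / volume (Metric.closedBall v r)) ^ 2) (𝓝[>] 0)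
      (𝓝 (P.rnDeriv volume v ^ 2)) := by
    filter_upwards [ae_restrict_of_ae (Besicovitch.ae_tendsto_rnDeriv P volume)] with v hv
    exact ((ENNReal.continuous_pow 2).tendsto _).comp hv
  calc ∫⁻ v in E, P.rnDeriv volume v ^ 2
      = ∫⁻ v in E, Filter.liminf
          (fun r => (P (Metric.closedBall v r) / volume (Metric.closedBall v r)) ^ 2) (𝓝[>] 0) :=
        lintegral_congr_ae (by filter_upwards [hae] with v hv using hv.liminf_eq.symm)
    _ ≤ Filter.liminf (fun r => ∫⁻ v in E,
          (P (Metric.closedBall v r) / volume (Metric.closedBall v r)) ^ 2) (𝓝[>] 0) := by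
        refine lintegral_liminf_le fun r => ?_
        exact ((measurable_measure_closedBall P r).div
          (measurable_measure_closedBall volume r)).pow_const 2
    _ ≤ K := by
        refine (Filter.liminf_le_limsup).trans (Filter.limsup_le_of_le (h := ?_))
        filter_upwards [Ioc_mem_nhdsGT hδ₀] with δ hδ
        set W := volume (Metric.closedBall (0 : R3) δ) with hW
        simp_rw [volume_closedBall_eq, ← hW, div_eq_mul_inv, mul_pow]
        rw [lintegral_mul_const _ ((measurable_measure_closedBall P δ).pow_const 2),
          ← ENNReal.inv_pow, ← div_eq_mul_inv]
        exact ENNReal.div_le_of_le_mul (h δ hδ.1 hδ.2)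

/-! ### Densities of complex push-forwards. -/

theorem measurable_add_prod : Measurable fun z : R3 × R3 => z.1 + z.2 :=
  measurable_fst.add measurable_snd

/-- The push-forward under addition of a nonnegative density dominated by one whose push-forward
is absolutely continuous. -/
theorem exists_density_of_nonneg {π : Measure (R3 × R3)} {u : R3 × R3 → ℂ} (hu : Integrable u π)
    (hac : ((π.withDensity fun z => ‖u z‖ₑ).map fun z => z.1 + z.2) ≪ volume)
    {r : R3 × R3 → ℝ} (hrm : Measurable r) (hr0 : ∀ z, 0 ≤ r z) (hru : ∀ z, r z ≤ ‖u z‖) :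
    ∃ k : R3 → ℂ, Integrable k ∧
      (∀ ψ : R3 → ℂ, Continuous ψ → ∫ v, k v * ψ v = ∫ z, (r z : ℂ) * ψ (z.1 + z.2) ∂π) ∧
      ∀ᵐ v, ‖k v‖ₑ ≤
        ((π.withDensity fun z => ‖u z‖ₑ).map fun z => z.1 + z.2).rnDeriv volume v := by
  set P := (π.withDensity fun z => ‖u z‖ₑ).map fun z => z.1 + z.2 with hP
  set Q := (π.withDensity fun z => ENNReal.ofReal (r z)).map fun z => z.1 + z.2 with hQ
  have : IsFiniteMeasure (π.withDensity fun z => ‖u z‖ₑ) :=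
    isFiniteMeasure_withDensity hu.hasFiniteIntegral.ne
  have hQP : Q ≤ P := by
    refine Measure.map_mono (withDensity_mono (ae_of_all _ fun z => ?_)) measurable_add_prod
    simp only [← ofReal_norm]
    exact ENNReal.ofReal_le_ofReal (hru z)
  have : IsFiniteMeasure P := by rw [hP]; infer_instance
  have : IsFiniteMeasure Q := isFiniteMeasure_of_le P hQP
  have hQac : Q ≪ volume := (Measure.absolutelyContinuous_of_le hQP).trans hac
  refine ⟨fun v => ((Q.rnDeriv volume v).toReal : ℂ), Measure.integrable_toReal_rnDeriv.ofReal,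
    fun ψ hψ => ?_, ?_⟩
  · have h1 := integral_rnDeriv_smul hQac (f := ψ)
    simp only [Complex.real_smul] at h1
    rw [h1, hQ, integral_map measurable_add_prod.aemeasurable hψ.aestronglyMeasurable,
      integral_withDensity_eq_integral_toReal_smul hrm.ennreal_ofReal
        (ae_of_all _ fun z => ENNReal.ofReal_lt_top)]
    simp [ENNReal.toReal_ofReal (hr0 _)]
  -- Both densities are limits of ball ratios, so `Q ≤ P` passes to them pointwise almost
  -- everywhere.
  · filter_upwards [Besicovitch.ae_tendsto_rnDeriv P volume,
      Besicovitch.ae_tendsto_rnDeriv Q volume, Q.rnDeriv_lt_top volume] with v h1 h2 h3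
    have e : ‖((Q.rnDeriv volume v).toReal : ℂ)‖ₑ = Q.rnDeriv volume v := by
      rw [← ofReal_norm, Complex.norm_real, Real.norm_of_nonneg ENNReal.toReal_nonneg,
        ENNReal.ofReal_toReal h3.ne]
    rw [e]
    exact le_of_tendsto_of_tendsto' h2 h1 fun δ => ENNReal.div_le_div_right (hQP _) _

theorem integral_sub_add_I_mul_sub {α : Type*} [MeasurableSpace α] {μ : Measure α}
    {a b c d : α → ℂ} (ha : Integrable a μ) (hb : Integrable b μ) (hc : Integrable c μ)
    (hd : Integrable d μ) :
    ∫ x, ((a x - b x) + Complex.I * (c x - d x)) ∂μ =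
      (∫ x, a x ∂μ - ∫ x, b x ∂μ) + Complex.I * (∫ x, c x ∂μ - ∫ x, d x ∂μ) := by
  rw [← integral_sub ha hb, ← integral_sub hc hd, ← integral_const_mul]
  exact integral_add (ha.sub hb) ((hc.sub hd).const_mul _)

/-- A complex density whose absolute value pushes forward under addition to an absolutely
continuous measure pushes forward to an integrable function. -/
theorem exists_density {π : Measure (R3 × R3)} {u : R3 × R3 → ℂ} (hum : Measurable u)
    (hu : Integrable u π)
    (hac : ((π.withDensity fun z => ‖u z‖ₑ).map fun z => z.1 + z.2) ≪ volume) :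
    ∃ h : R3 → ℂ, Integrable h ∧
      (∀ ψ : R3 → ℂ, Continuous ψ → HasCompactSupport ψ →
        ∫ v, h v * ψ v = ∫ z, u z * ψ (z.1 + z.2) ∂π) ∧
      ∀ᵐ v, ‖h v‖ₑ ≤
        4 * ((π.withDensity fun z => ‖u z‖ₑ).map fun z => z.1 + z.2).rnDeriv volume v := by
  have hre : Measurable fun z => (u z).re := Complex.measurable_re.comp hum
  have him : Measurable fun z => (u z).im := Complex.measurable_im.comp hum
  have hre' : Measurable fun z => -(u z).re := hre.neg
  have him' : Measurable fun z => -(u z).im := him.neg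
  have hposle : ∀ (s : ℝ) (c : ℂ), |s| ≤ ‖c‖ → max s 0 ≤ ‖c‖ := fun s c h =>
    max_le ((le_abs_self s).trans h) (norm_nonneg c)
  obtain ⟨k₁, i₁, e₁, b₁⟩ := exists_density_of_nonneg hu hac (hre.max measurable_const)
    (fun z => le_max_right _ 0) (fun z => hposle _ _ (Complex.abs_re_le_norm _))
  obtain ⟨k₂, i₂, e₂, b₂⟩ := exists_density_of_nonneg hu hac (hre'.max measurable_const)
    (fun z => le_max_right _ 0)
    (fun z => hposle _ _ (by rw [abs_neg]; exact Complex.abs_re_le_norm _))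
  obtain ⟨k₃, i₃, e₃, b₃⟩ := exists_density_of_nonneg hu hac (him.max measurable_const)
    (fun z => le_max_right _ 0) (fun z => hposle _ _ (Complex.abs_im_le_norm _))
  obtain ⟨k₄, i₄, e₄, b₄⟩ := exists_density_of_nonneg hu hac (him'.max measurable_const)
    (fun z => le_max_right _ 0)
    (fun z => hposle _ _ (by rw [abs_neg]; exact Complex.abs_im_le_norm _))
  refine ⟨fun v => (k₁ v - k₂ v) + Complex.I * (k₃ v - k₄ v),
    (i₁.sub i₂).add ((i₃.sub i₄).const_mul _), fun ψ hψ hψc => ?_, ?_⟩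
  · obtain ⟨M, hM⟩ := hψ.bounded_above_of_compact_support hψc
    have hint : ∀ k : R3 → ℂ, Integrable k → Integrable fun v => k v * ψ v := fun k hk =>
      hk.mul_bdd (c := M) hψ.aestronglyMeasurable (ae_of_all _ hM)
    have hψs : Measurable fun z : R3 × R3 => ψ (z.1 + z.2) :=
      hψ.measurable.comp measurable_add_prod
    have hint' : ∀ r : R3 × R3 → ℝ, Measurable r → (∀ z, 0 ≤ r z) → (∀ z, r z ≤ ‖u z‖) →
        Integrable (fun z => (r z : ℂ) * ψ (z.1 + z.2)) π := by
      intro r hr hr0 hru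
      refine Integrable.mul_bdd (c := M) ?_ hψs.aestronglyMeasurable (ae_of_all _ fun z => hM _)
      refine hu.mono (Complex.measurable_ofReal.comp hr).aestronglyMeasurable
        (ae_of_all _ fun z => ?_)
      rw [Complex.norm_real, Real.norm_of_nonneg (hr0 z)]
      exact hru z
    have j₁ := hint' _ (hre.max measurable_const)
      (fun z => le_max_right _ 0) (fun z => hposle _ _ (Complex.abs_re_le_norm _))
    have j₂ := hint' _ (hre'.max measurable_const) (fun z => le_max_right _ 0)
      (fun z => hposle _ _ (by rw [abs_neg]; exact Complex.abs_re_le_norm _))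
    have j₃ := hint' _ (him.max measurable_const)
      (fun z => le_max_right _ 0) (fun z => hposle _ _ (Complex.abs_im_le_norm _))
    have j₄ := hint' _ (him'.max measurable_const) (fun z => le_max_right _ 0)
      (fun z => hposle _ _ (by rw [abs_neg]; exact Complex.abs_im_le_norm _))
    have l : ∀ v, ((k₁ v - k₂ v) + Complex.I * (k₃ v - k₄ v)) * ψ v =
        (k₁ v * ψ v - k₂ v * ψ v) + Complex.I * (k₃ v * ψ v - k₄ v * ψ v) := fun v => by ring
    have hparts : ∀ s : ℝ, ((max s 0 : ℝ) : ℂ) - ((max (-s) 0 : ℝ) : ℂ) = (s : ℂ) := by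
      intro s
      rw [← Complex.ofReal_sub]
      congr 1
      rcases le_total s 0 with h | h
      · rw [max_eq_right h, max_eq_left (by linarith)]; ring
      · rw [max_eq_left h, max_eq_right (by linarith)]; ring
    have r' : ∀ z, u z * ψ (z.1 + z.2) =
        (((max (u z).re 0 : ℝ) : ℂ) * ψ (z.1 + z.2) -
          ((max (-(u z).re) 0 : ℝ) : ℂ) * ψ (z.1 + z.2)) +
        Complex.I * (((max (u z).im 0 : ℝ) : ℂ) * ψ (z.1 + z.2) -
          ((max (-(u z).im) 0 : ℝ) : ℂ) * ψ (z.1 + z.2)) := by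
      intro z
      rw [← sub_mul, ← sub_mul, hparts, hparts, ← mul_assoc, ← add_mul, mul_comm Complex.I,
        Complex.re_add_im]
    simp_rw [l, r']
    rw [integral_sub_add_I_mul_sub (hint _ i₁) (hint _ i₂) (hint _ i₃) (hint _ i₄),
      integral_sub_add_I_mul_sub j₁ j₂ j₃ j₄, e₁ ψ hψ, e₂ ψ hψ, e₃ ψ hψ, e₄ ψ hψ]
  · filter_upwards [b₁, b₂, b₃, b₄] with v h₁ h₂ h₃ h₄
    have hI : ‖Complex.I‖ₑ = 1 := by rw [← ofReal_norm, Complex.norm_I, ENNReal.ofReal_one]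
    calc ‖(k₁ v - k₂ v) + Complex.I * (k₃ v - k₄ v)‖ₑ
        ≤ (‖k₁ v‖ₑ + ‖k₂ v‖ₑ) + (‖k₃ v‖ₑ + ‖k₄ v‖ₑ) := by
          refine (enorm_add_le _ _).trans ?_
          rw [enorm_mul, hI, one_mul]
          exact add_le_add enorm_sub_le enorm_sub_le
      _ ≤ _ := by
          refine (add_le_add (add_le_add h₁ h₂) (add_le_add h₃ h₄)).trans (le_of_eq ?_)
          ring

/-! ### Assembling the estimate. -/

theorem sq_eLpNorm_two {α : Type*} [MeasurableSpace α] (μ : Measure α) (f : α → ℂ) :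
    eLpNorm f 2 μ ^ 2 = ∫⁻ x, ‖f x‖ₑ ^ 2 ∂μ := by
  have h := eLpNorm_nnreal_pow_eq_lintegral (μ := μ) (f := f) (p := 2) two_ne_zero
  simpa using h

theorem isFiniteMeasure_surfaceMeasure {S : Set R3} (hS : Bornology.IsBounded S) {c : ℝ}
    (hc : 0 < c) (h : ∀ p, surfaceMeasure S (Metric.closedBall p c) < ⊤) :
    IsFiniteMeasure (surfaceMeasure S) := by
  obtain ⟨t, ht, hcov⟩ := Metric.totallyBounded_iff.1 (hS.isCompact_closure.totallyBounded.subset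
    subset_closure) c hc
  refine ⟨?_⟩
  have e : surfaceMeasure S Set.univ = surfaceMeasure S S := by
    rw [surfaceMeasure, Measure.restrict_apply_univ, Measure.restrict_apply_self]
  rw [e]
  refine (measure_mono hcov).trans_lt (measure_biUnion_lt_top ht fun p _ => ?_)
  exact (measure_mono Metric.ball_subset_closedBall).trans_lt (h p)

/-- A ball meeting `S` has its centre within `δ` of `S`. The indicator is what turns products of
ball masses into volumes of triple intersections. -/
theorem surfaceMeasure_closedBall_le_indicator {S : Set R3} {m : ℝ≥0∞} {δ : ℝ}
    (h : ∀ p, surfaceMeasure S (Metric.closedBall p δ) ≤ m) (p : R3) :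
    surfaceMeasure S (Metric.closedBall p δ) ≤
      (Metric.cthickening δ S).indicator (fun _ => m) p := by
  by_cases hp : p ∈ Metric.cthickening δ S
  · rw [Set.indicator_of_mem hp]
    exact h p
  · rw [Set.indicator_of_notMem hp, surfaceMeasure,
      Measure.restrict_apply Metric.isClosed_closedBall.measurableSet]
    have : Metric.closedBall p δ ∩ S = ∅ := by
      refine Set.eq_empty_of_forall_notMem fun σ hσ => hp ?_
      exact Metric.mem_cthickening_of_dist_le p σ δ S hσ.2 (Metric.mem_closedBall'.1 hσ.1)
    rw [this, measure_empty]

/-- The `L²` bound for the mollified convolution of two transversal surfaces in a neighbourhood of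
a third one. -/
theorem exists_lintegral_sq_weightedConv_le {β : ℝ} (hβ : 0 < β) :
    ∃ (A : ℝ≥0) (c : ℝ), 0 < c ∧ ∀ (S S' : Fin 3 → Set R3) (n : Fin 3 → R3 → R3),
      SurfaceAssumption β 1 (1 / 2) S S' n → (∀ i, Metric.diam (S i) ≤ 1) →
      (∀ i, IsFiniteMeasure (surfaceMeasure (S i))) ∧
      ∀ F G : R3 → ℝ≥0∞, Measurable F → Measurable G → ∀ δ ε : ℝ, 0 < δ → δ ≤ ε → δ ≤ c →
        ∫⁻ v in Metric.cthickening ε (S 2),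
          weightedConv (surfaceMeasure (S 0)) (surfaceMeasure (S 1)) F G
            (Metric.closedBall v δ) ^ 2 ≤
        A * ENNReal.ofReal ε * (∫⁻ x, F x ^ 2 ∂(surfaceMeasure (S 0))) *
          (∫⁻ y, G y ^ 2 ∂(surfaceMeasure (S 1))) *
          volume (Metric.closedBall (0 : R3) δ) ^ 2 := by
  obtain ⟨C₁, c, hc, h₁⟩ := exists_surfaceMeasure_closedBall_le hβ
  obtain ⟨C₂, h₂⟩ := exists_volume_inter_le hβ
  set b := (volume (Metric.closedBall (0 : R3) 1)).toNNReal with hb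
  have hbt : volume (Metric.closedBall (0 : R3) 1) ≠ ⊤ := measure_closedBall_lt_top.ne
  have hbe : volume (Metric.closedBall (0 : R3) 1) = b := (ENNReal.coe_toNNReal hbt).symm
  have hb0 : b ≠ 0 := by
    rw [hb, ENNReal.toNNReal_ne_zero]
    exact ⟨(Metric.measure_closedBall_pos volume 0 one_pos).ne', hbt⟩
  -- The balls contribute `(C₁ δ²)²` and the intersection `C₂ ε δ²`; the last factor converts `δ⁶`
  -- into `|B_δ|² = b² δ⁶`.
  refine ⟨C₁ ^ 2 * C₂ * (b⁻¹) ^ 2, c, hc, fun S S' n hS hdiam => ?_⟩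
  have hm : ∀ i p δ, 0 < δ → δ ≤ c →
      surfaceMeasure (S i) (Metric.closedBall p δ) ≤ C₁ * ENNReal.ofReal (δ ^ 2) :=
    fun i => h₁ _ _ _ (hS.regular i) (hS.holder i)
  have hfin : ∀ i, IsFiniteMeasure (surfaceMeasure (S i)) := fun i =>
    isFiniteMeasure_surfaceMeasure (hS.regular i).1 hc fun p =>
      (hm i p c hc le_rfl).trans_lt (ENNReal.mul_lt_top ENNReal.coe_lt_top ENNReal.ofReal_lt_top)
  refine ⟨hfin, fun F G hF hG δ ε hδ hδε hδc => ?_⟩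
  have := hfin 0
  have := hfin 1
  have hε : 0 ≤ ε := hδ.le.trans hδε
  refine (lintegral_sq_weightedConv_closedBall_le _ _ hF hG
    Metric.isClosed_cthickening.measurableSet Metric.isClosed_cthickening.measurableSet
    (surfaceMeasure_closedBall_le_indicator fun p => hm 0 p δ hδ hδc)
    (surfaceMeasure_closedBall_le_indicator fun p => hm 1 p δ hδ hδc)
    (fun x y => h₂ S S' n hS hdiam x y δ ε hδ hδε)).trans (le_of_eq ?_)
  have hvol : volume (Metric.closedBall (0 : R3) δ) = ENNReal.ofReal δ ^ 3 * b := by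
    rw [Measure.addHaar_closedBall' volume 0 hδ.le, hbe, ENNReal.ofReal_pow hδ.le]
    simp
  have hbb : ((b⁻¹ : ℝ≥0) : ℝ≥0∞) ^ 2 * (b : ℝ≥0∞) ^ 2 = 1 := by
    rw [← mul_pow, ← ENNReal.coe_mul, inv_mul_cancel₀ hb0]
    simp
  rw [hvol, ENNReal.ofReal_mul hε, ENNReal.ofReal_pow hδ.le]
  push_cast
  generalize (∫⁻ x, F x ^ 2 ∂(surfaceMeasure (S 0))) = I
  generalize (∫⁻ x, G x ^ 2 ∂(surfaceMeasure (S 1))) = J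
  calc _ = (C₁ : ℝ≥0∞) ^ 2 * C₂ * ENNReal.ofReal ε * I * J * ENNReal.ofReal δ ^ 6 * 1 := by ring
    _ = _ := by rw [← hbb]; ring

/-- The convolution estimate for measurable functions. -/
theorem exists_convolution_of_measurable {β : ℝ} (hβ : 0 < β) :
    ∃ C : ℝ, 0 < C ∧
      ∀ (S S' : Fin 3 → Set R3) (n : Fin 3 → R3 → R3),
        SurfaceAssumption β 1 (1 / 2) S S' n →
        (∀ i, Metric.diam (S i) ≤ 1) →
        (S 2).Nonempty →
        ∀ f g : R3 → ℂ, Measurable f → Measurable g →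
          MemLp f 2 (surfaceMeasure (S 0)) → MemLp g 2 (surfaceMeasure (S 1)) →
          ∃ h : R3 → ℂ, IsSurfaceConvolution (S 0) (S 1) f g h ∧
            ∀ ε : ℝ, 0 < ε →
              eLpNorm h 2 (volume.restrict (Metric.cthickening ε (S 2))) ≤
                ENNReal.ofReal (C * √ε) * eLpNorm f 2 (surfaceMeasure (S 0)) *
                  eLpNorm g 2 (surfaceMeasure (S 1)) := by
  obtain ⟨A, c, hc, hA⟩ := exists_lintegral_sq_weightedConv_le hβ
  -- The four parts give a factor 16 after squaring, and `16 A ≤ (4 (A + 1))²`; the added 1 ensures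
  -- positivity.
  refine ⟨4 * (A + 1), by positivity, ?_⟩
  intro S S' n hS hdiam hne f g hfm hgm hf hg
  obtain ⟨hfin, hbound⟩ := hA S S' n hS hdiam
  have := hfin 0
  have := hfin 1
  set μ := surfaceMeasure (S 0) with hμ
  set ν := surfaceMeasure (S 1) with hν
  have hum : Measurable fun z : R3 × R3 => f z.1 * g z.2 :=
    (hfm.comp measurable_fst).mul (hgm.comp measurable_snd)
  have hu : Integrable (fun z : R3 × R3 => f z.1 * g z.2) (μ.prod ν) :=
    (hf.integrable one_le_two).mul_prod (hg.integrable one_le_two)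
  set P := weightedConv μ ν (fun x => ‖f x‖ₑ) (fun y => ‖g y‖ₑ) with hP
  have hPe : ((μ.prod ν).withDensity fun z => ‖f z.1 * g z.2‖ₑ).map (fun z => z.1 + z.2) = P := by
    simp_rw [enorm_mul]
    rfl
  have hPfin : IsFiniteMeasure P := by
    have : IsFiniteMeasure ((μ.prod ν).withDensity fun z => ‖f z.1 * g z.2‖ₑ) :=
      isFiniteMeasure_withDensity hu.hasFiniteIntegral.ne
    rw [← hPe]
    infer_instance
  have hP2 : ∀ δ ε : ℝ, 0 < δ → δ ≤ ε → δ ≤ c →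
      ∫⁻ v in Metric.cthickening ε (S 2), P (Metric.closedBall v δ) ^ 2 ≤
        A * ENNReal.ofReal ε * eLpNorm f 2 μ ^ 2 * eLpNorm g 2 ν ^ 2 *
          volume (Metric.closedBall (0 : R3) δ) ^ 2 := by
    intro δ ε h1 h2 h3
    rw [sq_eLpNorm_two, sq_eLpNorm_two]
    exact hbound _ _ hfm.enorm hgm.enorm δ ε h1 h2 h3
  have hPac : P ≪ volume := by
    refine absolutelyContinuous_of_lintegral_sq_closedBall_le P fun R => ?_
    obtain ⟨s, hs⟩ := hne
    -- The `L²` bound has no upper limit on `ε`, so a large neighbourhood of one point of the third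
    -- surface covers any given ball. This yields absolute continuity on the whole space.
    set ε := max (R + ‖s‖) 1 with hε
    have hε1 : 1 ≤ ε := le_max_right _ _
    refine ⟨A * ENNReal.ofReal ε * eLpNorm f 2 μ ^ 2 * eLpNorm g 2 ν ^ 2, ?_, min c 1,
      lt_min hc one_pos, fun δ hδ hδ' => ?_⟩
    · exact ENNReal.mul_ne_top (ENNReal.mul_ne_top (ENNReal.mul_ne_top ENNReal.coe_ne_top
        ENNReal.ofReal_ne_top) (ENNReal.pow_ne_top hf.2.ne)) (ENNReal.pow_ne_top hg.2.ne)
    · refine (lintegral_mono_set ?_).trans (hP2 δ ε hδ ((hδ'.trans (min_le_right _ _)).trans hε1)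
        (hδ'.trans (min_le_left _ _)))
      intro v hv
      refine Metric.mem_cthickening_of_dist_le v s ε _ hs ?_
      rw [mem_closedBall_zero_iff] at hv
      exact (dist_le_norm_add_norm v s).trans ((by linarith : _ ≤ R + ‖s‖).trans (le_max_left _ _))
  obtain ⟨h, hint, hconv, hle⟩ := exists_density hum hu (by rw [hPe]; exact hPac)
  rw [hPe] at hle
  refine ⟨h, ⟨hint, fun ψ hψ hψc => ?_⟩, fun ε hε => ?_⟩
  · rw [hconv ψ hψ.continuous hψc]
    obtain ⟨M, hM⟩ := hψ.continuous.bounded_above_of_compact_support hψc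
    refine integral_prod _ (hu.mul_bdd (c := M) ?_ (ae_of_all _ fun z => hM _))
    exact (hψ.continuous.measurable.comp measurable_add_prod).aestronglyMeasurable
  · have h1 : ∫⁻ v in Metric.cthickening ε (S 2), P.rnDeriv volume v ^ 2 ≤
        A * ENNReal.ofReal ε * eLpNorm f 2 μ ^ 2 * eLpNorm g 2 ν ^ 2 :=
      lintegral_sq_rnDeriv_le P _ (lt_min hc hε) fun δ hδ hδ' =>
        hP2 δ ε hδ (hδ'.trans (min_le_right _ _)) (hδ'.trans (min_le_left _ _))
    rw [← ENNReal.pow_le_pow_left_iff two_ne_zero, sq_eLpNorm_two]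
    have h2 : (16 * (A : ℝ≥0∞)) * ENNReal.ofReal ε ≤ ENNReal.ofReal (4 * (A + 1) * √ε) ^ 2 := by
      rw [← ENNReal.ofReal_pow (by positivity), mul_pow, Real.sq_sqrt hε.le,
        ENNReal.ofReal_mul (by positivity)]
      gcongr
      have : (16 * (A : ℝ≥0∞)) = ENNReal.ofReal (16 * A) := by
        rw [ENNReal.ofReal_mul (by norm_num), ENNReal.ofReal_coe_nnreal, ENNReal.ofReal_ofNat]
      rw [this]
      apply ENNReal.ofReal_le_ofReal
      nlinarith [A.coe_nonneg]
    calc ∫⁻ v in Metric.cthickening ε (S 2), ‖h v‖ₑ ^ 2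
        ≤ ∫⁻ v in Metric.cthickening ε (S 2), 16 * P.rnDeriv volume v ^ 2 := by
          refine lintegral_mono_ae ?_
          filter_upwards [ae_restrict_of_ae hle] with v hv
          calc ‖h v‖ₑ ^ 2 ≤ (4 * P.rnDeriv volume v) ^ 2 := by gcongr
            _ = _ := by rw [mul_pow]; norm_num
      _ = 16 * ∫⁻ v in Metric.cthickening ε (S 2), P.rnDeriv volume v ^ 2 :=
          lintegral_const_mul _ ((P.measurable_rnDeriv volume).pow_const 2)
      _ ≤ 16 * (A * ENNReal.ofReal ε * eLpNorm f 2 μ ^ 2 * eLpNorm g 2 ν ^ 2) := by gcongr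
      _ = 16 * A * ENNReal.ofReal ε * eLpNorm f 2 μ ^ 2 * eLpNorm g 2 ν ^ 2 := by ring
      _ ≤ ENNReal.ofReal (4 * (A + 1) * √ε) ^ 2 * eLpNorm f 2 μ ^ 2 * eLpNorm g 2 ν ^ 2 := by
          gcongr
      _ = _ := by ring

/-- It remains to pass to measurable representatives of `f` and `g`, which changes neither the norms
nor the iterated integral. -/
theorem mainTheorem2 (β : ℝ) (hβ0 : 0 < β) (hβ1 : β ≤ 1) :
    ∃ C : ℝ, 0 < C ∧
      ∀ (S S' : Fin 3 → Set R3) (n : Fin 3 → R3 → R3),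
        SurfaceAssumption β 1 (1 / 2) S S' n →
        (∀ i, Metric.diam (S i) ≤ 1) →
        (S 2).Nonempty →
        ∀ f g : R3 → ℂ,
          MemLp f 2 (surfaceMeasure (S 0)) → MemLp g 2 (surfaceMeasure (S 1)) →
          ∃ h : R3 → ℂ, IsSurfaceConvolution (S 0) (S 1) f g h ∧
            ∀ ε : ℝ, 0 < ε → ε ≤ 1 →
              eLpNorm h 2 (volume.restrict (Metric.cthickening ε (S 2))) ≤
                ENNReal.ofReal (C * √ε) * eLpNorm f 2 (surfaceMeasure (S 0)) *
                  eLpNorm g 2 (surfaceMeasure (S 1)) := by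
  obtain ⟨C, hC, hmain⟩ := exists_convolution_of_measurable hβ0
  refine ⟨C, hC, fun S S' n hS hdiam hne f g hf hg => ?_⟩
  have ef := hf.1.ae_eq_mk
  have eg := hg.1.ae_eq_mk
  obtain ⟨h, ⟨hint, hconv⟩, hle⟩ := hmain S S' n hS hdiam hne (hf.1.mk f) (hg.1.mk g)
    hf.1.stronglyMeasurable_mk.measurable hg.1.stronglyMeasurable_mk.measurable
    (hf.ae_eq ef) (hg.ae_eq eg)
  refine ⟨h, ⟨hint, fun ψ hψ hψc => ?_⟩, fun ε hε _ => ?_⟩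
  · rw [hconv ψ hψ hψc]
    refine integral_congr_ae ?_
    filter_upwards [ef] with x hx
    refine integral_congr_ae ?_
    filter_upwards [eg] with y hy
    rw [hx, hy]
  · rw [eLpNorm_congr_ae ef, eLpNorm_congr_ae eg]
    exact hle ε hε
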